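/- Let $p$ be an odd prime. Let $D$ be a diagram of an (unoriented) knot and let $\mathcal R(D)$ be its set of regions, i.e. the connected components of the complement of the underlying curve. Around each crossing of $D$ let $x_1,x_2,x_3,x_4$ be the four (not necessarily distinct) regions, named so that $x_2$ is separated from $x_1$ by an under-arc, $x_3$ is separated from $x_1$ by the over-arc, and $x_4$ is opposite to $x_1$. A *Dehn $p$-coloring* of $D$ is a map $C:\mathcal R(D)\to\mathbb Z/p\mathbb Z$ with $C(x_1)+C(x_3)=C(x_2)+C(x_4)$ at every crossing. It is *trivial* if $C(x_1)=C(x_4)$ and $C(x_2)=C(x_3)$ at every crossing, and *nontrivial* otherwise. A knot $K$ is *Dehn $p$-colorable* if some diagram of $K$ has a nontrivial Dehn $p$-coloring. For such a knot put $$\mathrm{mincol}_p(K)=\min\{\#\,C(\mathcal R(D)) : D \text{ a diagram of } K,\ C \text{ a nontrivial Dehn } p\text{-coloring of } D\}.$$ **Theorem.** Let $p\in\{13,29\}$. Then every Dehn $p$-colorable knot $K$ satisfies $$\mathrm{mincol}_p(K)\ \ge\ \lfloor \log_2 p\rfloor+3 .$$ Consequently, there is no Dehn $p$-colorable knot $K$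 with $\mathrm{mincol}_p(K)=\lfloor\log_2 p\rfloor+2$. -/

import Mathlib

/-- Combinatorial data of a link diagram drawn on an oriented closed surface: a 4-valent graph with
`n` crossings.  At each crossing `c` the four half-edges (darts) are numbered counterclockwise
`(c, 0), (c, 1), (c, 2), (c, 3)`, the under-strand being `(c, 0), (c, 2)` and the over-strand being
`(c, 1), (c, 3)`.  The involution `opp` sends a dart to the other end of its semiarc. -/
structure DiagramData where
  /-- the number of crossings -/
  n : ℕ
  /-- the other end of the semiarc that starts with a given dart -/
  opp : Fin n × ZMod 4 → Fin n × ZMod 4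
  opp_opp : ∀ d, opp (opp d) = d
  opp_ne : ∀ d, opp d ≠ d

namespace DiagramData

variable (D : DiagramData)

/-- The darts (half-edges at the crossings) of a diagram. -/
abbrev Dart : Type := Fin D.n × ZMod 4

variable {D}

/-- The dart reached by a counterclockwise turn of `k` quarters about the crossing. -/
def turn (k : ZMod 4) (d : D.Dart) : D.Dart := (d.1, d.2 + k)

/-- The dart belongs to the over-strand of its crossing. -/
def IsOver (d : D.Dart) : Prop := d.2 = 1 ∨ d.2 = 3

/-- A dart `d` also stands for the corner of its crossing between `d` and the next dart
counterclockwise, that is, for the side of the semiarc of `d` that lies on the left when one leaves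
the crossing along `d`.  Keeping the region on the left, the next corner of the same region is
`nextCorner d`. -/
def nextCorner (d : D.Dart) : D.Dart := turn (-1) (D.opp d)

variable (D)

/-- The regions of a diagram: the cycles of corners under `nextCorner`.  A diagram without
crossings is a simple closed curve, with two regions. -/
def Region : Type := Quot (fun d e : D.Dart => e = nextCorner d) ⊕ {_b : Bool // D.n = 0}

variable {D}

/-- The region that contains the corner between `d` and the next dart counterclockwise. -/
def corner (d : D.Dart) : D.Region := Sum.inl (Quot.mk _ d)

end DiagramData

/-- A diagram, on the sphere `ℝ² ∪ {∞}`, of an unoriented knot. -/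
structure KnotDiagram extends DiagramData where
  /-- There is one component only: walking along semiarcs and straight through crossings, one gets
  from any dart to any other. -/
  one_component : ∀ d e : toDiagramData.Dart,
    Relation.ReflTransGen
      (fun x y : toDiagramData.Dart => y = toDiagramData.opp x ∨ y = DiagramData.turn 2 x) d e
  /-- The underlying surface is the sphere: `V - E + F = 2` where `V = n` and `E = 2 * n`. -/
  planar : Nat.card toDiagramData.Region = n + 2

namespace KnotDiagram

open DiagramData

/-- The darts of a knot diagram. -/
abbrev Dart (D : KnotDiagram) : Type := D.toDiagramData.Dart

/-- The set `𝓡(D)` of regions of a knot diagram. -/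
abbrev Region (D : KnotDiagram) : Type := D.toDiagramData.Region

/-! ### Reidemeister moves -/

/-- `D` and `D'` are the same diagram up to isotopy of the oriented sphere. -/
def Isotopic (D D' : KnotDiagram) : Prop :=
  ∃ e : D.Dart ≃ D'.Dart,
    (∀ d, e (turn 1 d) = turn 1 (e d)) ∧
    (∀ d, IsOver (e d) ↔ IsOver d) ∧
    (∀ d, e (D.opp d) = D'.opp (e d))

/-- Leaving a crossing along a dart and going straight through crossings of `S` only, one can arrive
at a given dart. -/
inductive Passes (D : KnotDiagram) (S : Set (Fin D.n)) : D.Dart → D.Dart → Prop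
  | edge (d : D.Dart) : Passes D S d (D.opp d)
  | through (d e : D.Dart) : Passes D S d e → e.1 ∈ S → Passes D S d (D.opp (turn 2 e))

/-- `D` arises from `D'` by erasing the crossings in `S` and keeping the strands that run through
them: the darts of `D` are those of `D'` at the crossings outside `S`, and `opp` in `D` follows the
strand of `D'` up to the next crossing outside `S`. -/
def IsErasure (D D' : KnotDiagram) (S : Set (Fin D'.n)) : Prop :=
  ∃ f : D.Dart → D'.Dart, Function.Injective f ∧
    Set.range f = {d | d.1 ∉ S} ∧
    (∀ d, f (turn 1 d) = turn 1 (f d)) ∧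
    (∀ d, IsOver (f d) ↔ IsOver d) ∧
    (∀ d, D'.Passes S (f d) (f (D.opp d)))

/-- First Reidemeister move: `D` arises from `D'` by undoing a kink, that is, by erasing a crossing
one corner of which is a whole region. -/
def ReidemeisterI (D D' : KnotDiagram) : Prop :=
  ∃ a : D'.Dart, D'.opp a = turn 1 a ∧ IsErasure D D' {a.1}

/-- Second Reidemeister move: `D` arises from `D'` by erasing the two crossings of a region with
corners `a` and `b` only, one side of which is over at both ends (the other is then under at both
ends). -/
def ReidemeisterII (D D' : KnotDiagram) : Prop :=
  ∃ a b : D'.Dart, a.1 ≠ b.1 ∧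
    D'.opp a = turn 1 b ∧ D'.opp b = turn 1 a ∧
    (IsOver a ↔ IsOver (turn 1 b)) ∧
    IsErasure D D' {a.1, b.1}

/-- The exchange of darts in a third Reidemeister move along a triangular region with corners
`a`, `b`, `c` (counterclockwise).  The side from `a` to `b` lies on the strand
`turn 2 a`, `a`, `turn 1 b`, `turn 3 b`; after the move this strand meets the crossing of `b` first
and that of `a` second.  The same holds for the two other sides. -/
def triangleSwap {D : KnotDiagram} (a b c : D.Dart) : Equiv.Perm D.Dart :=
  Equiv.swap (turn 2 a) (turn 1 b) * Equiv.swap a (turn 3 b) *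
  (Equiv.swap (turn 2 b) (turn 1 c) * Equiv.swap b (turn 3 c)) *
  (Equiv.swap (turn 2 c) (turn 1 a) * Equiv.swap c (turn 3 a))

/-- Third Reidemeister move along a triangular region with corners `a`, `b`, `c` at three different
crossings, where the strand through the side from `a` to `b` is over at both ends. -/
def ReidemeisterIII (D D' : KnotDiagram) : Prop :=
  ∃ a b c : D.Dart, a.1 ≠ b.1 ∧ b.1 ≠ c.1 ∧ c.1 ≠ a.1 ∧
    D.opp a = turn 1 b ∧ D.opp b = turn 1 c ∧ D.opp c = turn 1 a ∧
    IsOver a ∧ IsOver (turn 1 b) ∧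
    ∃ e : D.Dart ≃ D'.Dart,
      (∀ d, e (turn 1 d) = turn 1 (e d)) ∧
      (∀ d, IsOver (e d) ↔ IsOver d) ∧
      (∀ d, e (triangleSwap a b c (D.opp (triangleSwap a b c d))) = D'.opp (e d))

/-- One isotopy of the sphere or one Reidemeister move. -/
def Move (D D' : KnotDiagram) : Prop :=
  Isotopic D D' ∨ ReidemeisterI D D' ∨ ReidemeisterII D D' ∨ ReidemeisterIII D D'

/-- Two diagrams represent the same knot when they are related by a finite sequence of isotopies,
Reidemeister moves and their inverses. -/
instance setoid : Setoid KnotDiagram := Relation.EqvGen.setoid Move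

end KnotDiagram

/-- (Unoriented) knots: knot diagrams up to isotopy and Reidemeister moves. -/
def Knot : Type := Quotient KnotDiagram.setoid

/-- `D` is a diagram of the knot `K`. -/
def KnotDiagram.IsDiagramOf (D : KnotDiagram) (K : Knot) : Prop := Quotient.mk _ D = K

/-! ### Dehn colorings -/

namespace KnotDiagram

open DiagramData

variable (D : KnotDiagram)

/-- The region `x₁` at a crossing.  The four regions `x₁, x₂, x₃, x₄` around a crossing need not be
distinct. -/
def x₁ (c : Fin D.n) : D.Region := corner (c, 0)

/-- The region `x₂`, which the under-arc `(c, 0)` separates from `x₁`. -/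
def x₂ (c : Fin D.n) : D.Region := corner (c, 3)

/-- The region `x₃`, which the over-arc `(c, 1)` separates from `x₁`. -/
def x₃ (c : Fin D.n) : D.Region := corner (c, 1)

/-- The region `x₄`, opposite to `x₁`. -/
def x₄ (c : Fin D.n) : D.Region := corner (c, 2)

/-- Dehn `p`-colorings of a diagram. -/
def IsDehnColoring (p : ℕ) (C : D.Region → ZMod p) : Prop :=
  ∀ c : Fin D.n, C (D.x₁ c) + C (D.x₃ c) = C (D.x₂ c) + C (D.x₄ c)

/-- A coloring is trivial if every crossing is trivially colored. -/
def IsTrivialColoring {p : ℕ} (C : D.Region → ZMod p) : Prop :=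
  ∀ c : Fin D.n, C (D.x₁ c) = C (D.x₄ c) ∧ C (D.x₃ c) = C (D.x₂ c)

/-- Nontrivial Dehn `p`-colorings of a diagram. -/
def IsNontrivialDehnColoring (p : ℕ) (C : D.Region → ZMod p) : Prop :=
  D.IsDehnColoring p C ∧ ¬ D.IsTrivialColoring C

end KnotDiagram

/-- A knot is Dehn `p`-colorable if some diagram of it has a nontrivial Dehn `p`-coloring. -/
def Knot.DehnColorable (p : ℕ) (K : Knot) : Prop :=
  ∃ D : KnotDiagram, D.IsDiagramOf K ∧ ∃ C : D.Region → ZMod p, D.IsNontrivialDehnColoring p C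

/-- The minimum number of colors `mincol_p(K)`: the least number of elements in the image of a
nontrivial Dehn `p`-coloring of a diagram of `K` (meaningful for Dehn `p`-colorable knots). -/
noncomputable def Knot.mincol (p : ℕ) (K : Knot) : ℕ :=
  sInf {k : ℕ | ∃ D : KnotDiagram, D.IsDiagramOf K ∧
    ∃ C : D.Region → ZMod p, D.IsNontrivialDehnColoring p C ∧ k = (Set.range C).ncard}

/-! ### Parity functions and Dehn colorings -/

/-- A `Bool`-valued function `f` that is not constant on `S` and turns Dehn colorings with colors in
`S` into Dehn colorings modulo 2, as long as the predicate `g` is constant on the sums of the two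
colors along a semiarc. -/
def HasParity {p : ℕ} (S : Set (ZMod p)) : Prop :=
  ∃ f g : ZMod p → Bool, (∃ u ∈ S, ∃ w ∈ S, f u = false ∧ f w = true) ∧
    ∀ a ∈ S, ∀ b ∈ S, ∀ c ∈ S, ∀ d ∈ S, a + c = b + d →
      g (a + b) = g (c + d) ∧
      (((f a ^^ f c) = (f b ^^ f d)) ∨ g (a + b) ≠ g (a + c))

/-! ### Walking along the knot and merging two colors -/

namespace DiagramData

variable {D : DiagramData}

theorem corner_turn_opp (d : D.Dart) :
    (corner (turn (-1) (D.opp d)) : D.Region) = corner d :=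
  congrArg Sum.inl (Quot.sound (r := fun d e : D.Dart => e = nextCorner d) rfl).symm

theorem corner_opp (d : D.Dart) : (corner (D.opp d) : D.Region) = corner (turn (-1) d) := by
  rw [← corner_turn_opp (D.opp d), D.opp_opp]

end DiagramData

namespace KnotDiagram

open DiagramData

variable {D : KnotDiagram} {p : ℕ}

/-- A function on darts that is unchanged along semiarcs and straight through crossings is
constant. -/
theorem eq_of_walk {α : Type*} (F : D.Dart → α) (h₁ : ∀ d, F (D.opp d) = F d)
    (h₂ : ∀ d, F (turn 2 d) = F d) (d e : D.Dart) : F d = F e := by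
  induction D.one_component d e with
  | refl => rfl
  | tail _ h ih => rcases h with rfl | rfl <;> simp [ih, h₁, h₂]

theorem zmod_four_cases (i : ZMod 4) : i = 0 ∨ i = 1 ∨ i = 2 ∨ i = 3 := by
  revert i; decide

/-- The hypotheses in `h` compare the two under-arcs and the two over-arcs of a crossing. Symmetry
of `G` is needed because a half turn exchanges the sides of a strand. -/
theorem turn_two_eq_of_crossing {α : Type*} (G : D.Region → D.Region → α)
    (hG : ∀ x y, G x y = G y x)
    (h : ∀ c, G (D.x₁ c) (D.x₂ c) = G (D.x₃ c) (D.x₄ c) ∧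
      G (D.x₁ c) (D.x₃ c) = G (D.x₂ c) (D.x₄ c)) (d : D.Dart) :
    G (corner (turn 2 d)) (corner (turn (-1) (turn 2 d))) = G (corner d) (corner (turn (-1) d)) := by
  obtain ⟨c, i⟩ := d
  have e1 : (2 : ZMod 4) + -1 = 1 := by decide
  have e2 : (0 : ZMod 4) + -1 = 3 := by decide
  have e3 : (1 : ZMod 4) + 2 = 3 := by decide
  have e4 : (3 : ZMod 4) + -1 = 2 := by decide
  have e5 : (1 : ZMod 4) + -1 = 0 := by decide
  have e6 : (2 : ZMod 4) + 2 = 0 := by decide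
  have e7 : (3 : ZMod 4) + 2 = 1 := by decide
  have h1 := (h c).1
  have h2 := (h c).2
  simp only [x₁, x₂, x₃, x₄] at h1 h2
  rcases zmod_four_cases i with rfl | rfl | rfl | rfl <;>
    simp only [turn, zero_add, e1, e2, e3, e4, e5, e6, e7]
  · rw [h1, hG]
  · rw [hG (corner (c, 1)), h2, hG]
  · rw [h1, hG (corner (c, 1))]
  · rw [hG (corner (c, 1)), h2, hG]

theorem dart_of_region (hn : D.n ≠ 0) (r : D.Region) : ∃ d : D.Dart, r = corner d := by
  rcases r with q | ⟨_, h⟩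
  · obtain ⟨d, rfl⟩ := Quot.exists_rep q
    exact ⟨d, rfl⟩
  · exact absurd h hn

/-- A nontrivial coloring whose colors admit a parity function can be replaced by one with fewer
colors: the parity function turns out to be a checkerboard coloring, which is subtracted. -/
theorem exists_fewer_colors [NeZero p] {C : D.Region → ZMod p}
    (hC : D.IsNontrivialDehnColoring p C) (hS : HasParity (Set.range C)) :
    ∃ C' : D.Region → ZMod p, D.IsNontrivialDehnColoring p C' ∧
      (Set.range C').ncard < (Set.range C).ncard := by
  obtain ⟨f, g, ⟨u, ⟨ru, rfl⟩, w, ⟨rw', rfl⟩, hu, hw⟩, hfg⟩ := hS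
  obtain ⟨hC, hnt⟩ := hC
  have hn : D.n ≠ 0 := by
    intro h0
    exact hnt fun c => absurd c.2 (by omega)
  have rel : ∀ c, _ := fun c => hfg _ ⟨D.x₁ c, rfl⟩ _ ⟨D.x₂ c, rfl⟩ _ ⟨D.x₃ c, rfl⟩ _
    ⟨D.x₄ c, rfl⟩ (hC c)
  -- On over-strands the sum itself is preserved, by the Dehn relation; on under-strands parity only
  -- gives that its `g`-value is.
  have gconst : ∀ d e : D.Dart, g (C (corner d) + C (corner (turn (-1) d))) =
      g (C (corner e) + C (corner (turn (-1) e))) := by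
    refine eq_of_walk _ (fun d => ?_) (fun d => ?_)
    · rw [corner_turn_opp, corner_opp, add_comm]
    · exact turn_two_eq_of_crossing (fun x y => g (C x + C y))
        (fun x y => by simp only [add_comm]) (fun c => ⟨(rel c).1, by simp only [hC c]⟩) d
  have fpar : ∀ c, (f (C (D.x₁ c)) ^^ f (C (D.x₃ c))) = (f (C (D.x₂ c)) ^^ f (C (D.x₄ c))) := by
    intro c
    refine (rel c).2.resolve_right fun hne => hne ?_
    have := gconst (c, 0) (c, 1)
    have e2 : (0 : ZMod 4) + -1 = 3 := by decide
    have e5 : (1 : ZMod 4) + -1 = 0 := by decide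
    simp only [turn, e2, e5] at this
    rw [add_comm (C (D.x₁ c)) (C (D.x₃ c))]
    exact this
  have fconst : ∀ d e : D.Dart, (f (C (corner d)) ^^ f (C (corner (turn (-1) d)))) =
      (f (C (corner e)) ^^ f (C (corner (turn (-1) e)))) := by
    refine eq_of_walk _ (fun d => ?_) (fun d => ?_)
    · rw [corner_turn_opp, corner_opp, Bool.xor_comm]
    · refine turn_two_eq_of_crossing (fun x y => f (C x) ^^ f (C y))
        (fun x y => Bool.xor_comm _ _) (fun c => ⟨?_, fpar c⟩) d
      have := fpar c
      revert this
      cases f (C (D.x₁ c)) <;> cases f (C (D.x₂ c)) <;> cases f (C (D.x₃ c)) <;>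
        cases f (C (D.x₄ c)) <;> simp
  obtain ⟨du, rfl⟩ := dart_of_region hn ru
  obtain ⟨dw, rfl⟩ := dart_of_region hn rw'
  -- The two regions along a semiarc have different parities.
  have alt : ∀ d : D.Dart, f (C (corner d)) = !f (C (corner (turn (-1) d))) := by
    intro d
    by_contra hd
    have hd' : (f (C (corner d)) ^^ f (C (corner (turn (-1) d)))) = false := by
      revert hd
      cases f (C (corner d)) <;> cases f (C (corner (turn (-1) d))) <;> simp
    have hall : ∀ e : D.Dart, f (C (corner (turn (-1) e))) = f (C (corner e)) := fun e => by
      have := (fconst e d).trans hd'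
      revert this
      cases f (C (corner e)) <;> cases f (C (corner (turn (-1) e))) <;> simp
    -- Otherwise `f` is unchanged across every semiarc, hence takes one value on all regions,
    -- against `hu` and `hw`.
    have := eq_of_walk (fun e : D.Dart => f (C (corner e)))
      (fun e => by simp only [corner_opp, hall])
      (fun e => by
        have e2 : (turn 2 e : D.Dart) = turn (-1) (turn (-1) e) := by
          obtain ⟨c, i⟩ := e
          have : i + 2 = i + -1 + -1 := by revert i; decide
          simp only [turn, this]
        simp only [e2, hall]) du dw
    simp [hu, hw] at this
  have hsq : ∀ c, f (C (D.x₁ c)) = f (C (D.x₄ c)) ∧ f (C (D.x₂ c)) = f (C (D.x₃ c)) := by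
    intro c
    have a1 := alt (c, 1)
    have a2 := alt (c, 2)
    have a3 := alt (c, 3)
    have e1 : (2 : ZMod 4) + -1 = 1 := by decide
    have e4 : (3 : ZMod 4) + -1 = 2 := by decide
    have e5 : (1 : ZMod 4) + -1 = 0 := by decide
    simp only [turn, e1, e4, e5] at a1 a2 a3
    exact ⟨by rw [x₁, x₄, a2, a1, Bool.not_not], by rw [x₂, x₃, a3, a2, Bool.not_not]⟩
  -- The shift sends the color of `dw` to that of `du`. By `hsq` it cancels in the Dehn relation and
  -- in both equations defining triviality.
  let sh : ZMod p → ZMod p := fun s => if f s then s + (C (corner du) - C (corner dw)) else s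
  refine ⟨fun r => sh (C r), ⟨fun c => ?_, fun htr => hnt fun c => ?_⟩, ?_⟩
  · have := hC c
    simp only [sh, (hsq c).1, (hsq c).2]
    split_ifs <;> linear_combination this
  · have := htr c
    simp only [sh, (hsq c).1, (hsq c).2] at this
    split_ifs at this <;> simpa using this
  · have hr : Set.range (fun r => sh (C r)) = sh '' Set.range C := by
      rw [← Set.range_comp]; rfl
    rw [hr]
    refine lt_of_le_of_ne (Set.ncard_image_le (Set.toFinite _)) fun heq => ?_
    have hinj := Set.injOn_of_ncard_image_eq heq (Set.toFinite _)
    have : C (corner du) = C (corner dw) := hinj ⟨_, rfl⟩ ⟨_, rfl⟩ (by simp [sh, hu, hw])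
    rw [this, hw] at hu
    exact absurd hu (by simp)

/-- If all sets of at least two and at most `n` colors admit a parity function, then nontrivial
Dehn colorings have more than `n` colors. -/
theorem lt_ncard_range [NeZero p] {n : ℕ}
    (h : ∀ S : Set (ZMod p), 2 ≤ S.ncard → S.ncard ≤ n → HasParity S) (C : D.Region → ZMod p)
    (hC : D.IsNontrivialDehnColoring p C) : n < (Set.range C).ncard := by
  induction hk : (Set.range C).ncard using Nat.strong_induction_on generalizing C with
  | _ k ih =>
    subst hk
    by_contra! hle
    have h2 : 2 ≤ (Set.range C).ncard := by
      by_contra! hlt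
      have hsub := (Set.ncard_le_one (Set.toFinite _)).1 (Nat.le_of_lt_succ hlt)
      exact hC.2 fun c => ⟨hsub _ ⟨_, rfl⟩ _ ⟨_, rfl⟩, hsub _ ⟨_, rfl⟩ _ ⟨_, rfl⟩⟩
    obtain ⟨C', hC', hlt⟩ := exists_fewer_colors hC (h _ h2 hle)
    have := ih _ hlt C' hC' rfl
    omega

end KnotDiagram

theorem Knot.lt_mincol {p n : ℕ} [NeZero p]
    (h : ∀ S : Set (ZMod p), 2 ≤ S.ncard → S.ncard ≤ n → HasParity S) {K : Knot}
    (hK : K.DehnColorable p) : n < K.mincol p := by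
  obtain ⟨D, hD, C, hC⟩ := hK
  obtain ⟨D', -, C', hC', hk⟩ := Nat.sInf_mem (s := {k : ℕ | ∃ D : KnotDiagram, D.IsDiagramOf K ∧
    ∃ C : D.Region → ZMod p, D.IsNontrivialDehnColoring p C ∧ k = (Set.range C).ncard})
    ⟨_, D, hD, C, hC, rfl⟩
  rw [Knot.mincol, hk]
  exact KnotDiagram.lt_ncard_range h C' hC'

/-- Affine maps preserve the relation a + c = b + d. A sum of two elements picks up the translation
twice, hence `2 * a` in the new `g`. -/
theorem HasParity.affine {p : ℕ} {B S : Set (ZMod p)} (a b : ZMod p) (hb : IsUnit b)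
    (hS : ∀ y, y ∈ S ↔ ∃ s ∈ B, a + b * s = y) (hB : HasParity B) : HasParity S := by
  obtain ⟨f, g, ⟨u, hu, w, hw, hfu, hfw⟩, h⟩ := hB
  obtain ⟨b', hb'⟩ := hb.exists_left_inv
  have hf : ∀ s, b' * (a + b * s - a) = s := fun s => by linear_combination s * hb'
  have hg : ∀ s t, b' * (a + b * s + (a + b * t) - 2 * a) = s + t := fun s t => by
    linear_combination (s + t) * hb'
  refine ⟨fun y => f (b' * (y - a)), fun y => g (b' * (y - 2 * a)),
    ⟨_, (hS _).2 ⟨u, hu, rfl⟩, _, (hS _).2 ⟨w, hw, rfl⟩, by simpa only [hf], by simpa only [hf]⟩, ?_⟩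
  simp only [hS]
  rintro _ ⟨x, hx, rfl⟩ _ ⟨y, hy, rfl⟩ _ ⟨z, hz, rfl⟩ _ ⟨t, ht, rfl⟩ he
  simp only [hf, hg]
  exact h x hx y hy z hz t ht (by linear_combination b' * he - (x + z - y - t) * hb')
/-! ### Exhaustive search for parity functions -/

namespace ParitySearch

/-- No number in the set coded by `e` is congruent modulo `p` to one in the set coded by `o`, where
the numbers are less than `2 * p`. -/
def separated (p e o : ℕ) : Bool :=
  -- The shift by `p` reduces the entries from `p` to `2 * p - 1`; the remainder mod `2 ^ p` keeps
  -- only reduced residues.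
  (((e ||| e >>> p) &&& (o ||| o >>> p)) % 2 ^ p).beq 0

/-- Some way to distribute the entries of a list to two sets coded by `t` and `u` makes these sets
nonempty and the sums `e` within a set separated from the mixed sums `o`. -/
def splits (p : ℕ) : List ℕ → ℕ → ℕ → ℕ → ℕ → Bool
  | [], t, u, e, o => separated p e o && (!(t.beq 0) && !(u.beq 0))
  -- The masks only grow, so a branch that fails the test can be pruned.
  | x :: l, t, u, e, o => separated p e o &&
      (splits p l t (u ||| 1 <<< x) (e ||| (u ||| 1 <<< x) <<< x) (o ||| t <<< x) ||
      splits p l (t ||| 1 <<< x) u (e ||| (t ||| 1 <<< x) <<< x) (o ||| u <<< x))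

/-- The entries of the list are the values of an affine function at the entries of `base`. -/
def affineIn (p : ℕ) (base l : List ℕ) : Bool :=
  -- `a` and `c` are the images of 0 and 1; `c + (p - a)` stands for c - a without truncation when
  -- `a < p`.
  l.any fun a => l.any fun c => !(a.beq c) &&
    ((l.all fun y => base.any fun s => ((a + (c + (p - a)) * s) % p).beq y) &&
      base.all fun s => l.any fun y => ((a + (c + (p - a)) * s) % p).beq y)

/-- All lists that arise from `l` by adding at most `k` entries of a given list split or are affine
images of `base`. -/
def search (p : ℕ) (base : List ℕ) : List ℕ → ℕ → List ℕ → Bool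
  | [], _, l => splits p l 0 0 0 0 || affineIn p base l
  | _ :: _, 0, l => splits p l 0 0 0 0 || affineIn p base l
  | x :: xs, k + 1, l => search p base xs k (x :: l) && search p base xs (k + 1) l

set_option maxRecDepth 100000 in
theorem search_thirteen : search 13 [0, 1, 2, 4, 7] (List.range' 2 11) 3 [1, 0] = true := by
  decide +kernel

set_option maxRecDepth 100000 in
theorem search_twentynine :
    search 29 [0, 1, 2, 4, 8, 15] (List.range' 2 27) 4 [1, 0] = true := by
  decide +kernel

/-! ### Correctness of the search -/

theorem ne_mod_of_separated {p e o : ℕ} (h : separated p e o = true) {x y : ℕ}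
    (hx : x < 2 * p) (hy : y < 2 * p) (hex : e.testBit x = true) (hoy : o.testBit y = true) :
    x % p ≠ y % p := by
  intro hxy
  have key : ∀ m z : ℕ, z < 2 * p → m.testBit z = true → (m ||| m >>> p).testBit (z % p) = true := by
    intro m z hz hm
    rw [Nat.testBit_or, Nat.testBit_shiftRight]
    rcases lt_or_ge z p with h1 | h1
    · rw [Nat.mod_eq_of_lt h1, hm, Bool.true_or]
    · rw [Nat.mod_eq_sub_mod h1, Nat.mod_eq_of_lt (by omega), Nat.add_sub_cancel' h1, hm,
        Bool.or_true]
  have h0 := Nat.eq_of_beq_eq_true h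
  have h1 : (((e ||| e >>> p) &&& (o ||| o >>> p)) % 2 ^ p).testBit (x % p) = true := by
    rw [Nat.testBit_mod_two_pow, Nat.testBit_and, key e x hx hex, hxy, key o y hy hoy]
    simp [Nat.mod_lt y (show 0 < p by omega)]
  rw [h0] at h1
  simp at h1

/-- The mask `e` contains the sums within the sets coded by `t` and `u`, and `o` contains the mixed
sums; these sets consist of numbers less than `p`. -/
structure Invariant (p t u e o : ℕ) : Prop where
  left_lt : ∀ x, t.testBit x = true → x < p
  right_lt : ∀ x, u.testBit x = true → x < p
  left : ∀ x y, t.testBit x = true → t.testBit y = true → e.testBit (x + y) = true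
  right : ∀ x y, u.testBit x = true → u.testBit y = true → e.testBit (x + y) = true
  mixed : ∀ x y, t.testBit x = true → u.testBit y = true → o.testBit (x + y) = true

theorem Invariant.symm {p t u e o : ℕ} (h : Invariant p t u e o) : Invariant p u t e o :=
  ⟨h.right_lt, h.left_lt, h.right, h.left, fun x y hx hy => add_comm y x ▸ h.mixed y x hy hx⟩

theorem testBit_insert {t x y : ℕ} : (t ||| 1 <<< x).testBit y = true ↔ t.testBit y = true ∨ y = x := by
  rw [Nat.testBit_or, Nat.one_shiftLeft, Nat.testBit_two_pow, Bool.or_eq_true, decide_eq_true_eq,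
    @eq_comm _ x]

theorem testBit_or_shiftLeft {e m x y : ℕ} (h : e.testBit (x + y) = true ∨ m.testBit y = true) :
    (e ||| m <<< x).testBit (x + y) = true := by
  rw [Nat.testBit_or, Nat.testBit_shiftLeft]
  simpa using h

theorem Invariant.insert {p t u e o x : ℕ} (h : Invariant p t u e o) (hx : x < p) :
    Invariant p (t ||| 1 <<< x) u (e ||| (t ||| 1 <<< x) <<< x) (o ||| u <<< x) where
  left_lt y hy := by
    rcases testBit_insert.1 hy with hy | rfl
    exacts [h.left_lt y hy, hx]
  right_lt := h.right_lt
  left y z hy hz := by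
    rcases testBit_insert.1 hy with hy' | rfl
    · rcases testBit_insert.1 hz with hz' | rfl
      · rw [Nat.testBit_or, h.left y z hy' hz', Bool.true_or]
      · rw [add_comm]
        exact testBit_or_shiftLeft (Or.inr hy)
    · exact testBit_or_shiftLeft (Or.inr hz)
  right y z hy hz := by rw [Nat.testBit_or, h.right y z hy hz, Bool.true_or]
  mixed y z hy hz := by
    rcases testBit_insert.1 hy with hy' | rfl
    · rw [Nat.testBit_or, h.mixed y z hy' hz, Bool.true_or]
    · exact testBit_or_shiftLeft (Or.inr hz)

theorem exists_of_splits {p : ℕ} (l : List ℕ) (hl : ∀ x ∈ l, x < p) (t u e o : ℕ)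
    (h : splits p l t u e o = true) (hI : Invariant p t u e o) :
    ∃ t' u' e' o', Invariant p t' u' e' o' ∧ separated p e' o' = true ∧ t' ≠ 0 ∧ u' ≠ 0 ∧
      ∀ x, (t'.testBit x = true ∨ u'.testBit x = true) ↔
        (t.testBit x = true ∨ u.testBit x = true) ∨ x ∈ l := by
  induction l generalizing t u e o with
  | nil =>
    simp only [splits, Bool.and_eq_true, Bool.not_eq_true'] at h
    exact ⟨t, u, e, o, hI, h.1, Nat.ne_of_beq_eq_false h.2.1, Nat.ne_of_beq_eq_false h.2.2, by simp⟩
  | cons x l ih =>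
    simp only [splits, Bool.and_eq_true, Bool.or_eq_true] at h
    have hx := hl x List.mem_cons_self
    have hl' : ∀ y ∈ l, y < p := fun y hy => hl y (List.mem_cons_of_mem _ hy)
    rcases h.2 with h | h
    · obtain ⟨t', u', e', o', h1, h2, h3, h4, h5⟩ := ih hl' _ _ _ _ h (hI.symm.insert hx).symm
      refine ⟨t', u', e', o', h1, h2, h3, h4, fun y => ?_⟩
      rw [h5, testBit_insert, List.mem_cons]
      tauto
    · obtain ⟨t', u', e', o', h1, h2, h3, h4, h5⟩ := ih hl' _ _ _ _ h (hI.insert hx)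
      refine ⟨t', u', e', o', h1, h2, h3, h4, fun y => ?_⟩
      rw [h5, testBit_insert, List.mem_cons]
      tauto

/-- The residue classes of the entries of a list. -/
def classes (p : ℕ) (l : List ℕ) : Set (ZMod p) := {x | ∃ a ∈ l, (a : ZMod p) = x}

theorem hasParity_of_splits {p : ℕ} [NeZero p] {l : List ℕ} (hl : ∀ x ∈ l, x < p)
    (h : splits p l 0 0 0 0 = true) : HasParity (classes p l) := by
  obtain ⟨t, u, e, o, hI, hsep, ht, hu, hmem⟩ :=
    exists_of_splits l hl 0 0 0 0 h (by constructor <;> simp)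
  simp only [Nat.zero_testBit, Bool.false_eq_true, or_self, false_or] at hmem
  have hval : ∀ {x : ℕ}, x ∈ l → ((x : ZMod p)).val = x := fun hx => ZMod.val_cast_of_lt (hl _ hx)
  -- For a common element `x`, the sum `x + x` would be both a sum within a set and a mixed sum.
  have hdisj : ∀ x, u.testBit x = true → t.testBit x = false := by
    intro x hux
    by_contra htx
    have htx : t.testBit x = true := by simpa using htx
    have := hI.left_lt x htx
    exact ne_mod_of_separated hsep (by omega) (by omega) (hI.left x x htx htx)
      (hI.mixed x x htx hux) rfl
  obtain ⟨a, ha⟩ := Nat.exists_testBit_of_ne_zero ht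
  obtain ⟨b, hb⟩ := Nat.exists_testBit_of_ne_zero hu
  have hal := (hmem a).1 (Or.inl ha)
  have hbl := (hmem b).1 (Or.inr hb)
  -- A constant `g` allows no exceptional relation.
  refine ⟨fun x => t.testBit x.val, fun _ => false, ⟨b, ⟨b, hbl, rfl⟩, a, ⟨a, hal, rfl⟩, ?_, ?_⟩, ?_⟩
  · simp only [hval hbl, hdisj b hb]
  · simp only [hval hal, ha]
  -- A relation between a sum within a set and a mixed sum.
  have key : ∀ a ∈ l, ∀ b ∈ l, ∀ c ∈ l, ∀ d ∈ l, (a : ZMod p) + c = b + d →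
      (t.testBit a ^^ t.testBit c) = false → (t.testBit b ^^ t.testBit d) = true → False := by
    intro a ha b hb c hc d hd he hac hbd
    have hmod : (a + c) % p = (b + d) % p := by
      rw [← Nat.ModEq, ← ZMod.natCast_eq_natCast_iff]
      exact_mod_cast he
    have := hl a ha; have := hl b hb; have := hl c hc; have := hl d hd
    have hu' : ∀ x ∈ l, t.testBit x = false → u.testBit x = true := fun x hx h0 =>
      ((hmem x).2 hx).resolve_left (by simp [h0])
    have h1 : e.testBit (a + c) = true := by
      cases h1 : t.testBit a <;> cases h2 : t.testBit c <;> simp [h1, h2] at hac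
      · exact hI.right _ _ (hu' a ha h1) (hu' c hc h2)
      · exact hI.left _ _ h1 h2
    have h2 : o.testBit (b + d) = true := by
      cases h1 : t.testBit b <;> cases h2 : t.testBit d <;> simp [h1, h2] at hbd
      · exact hI.symm.mixed _ _ (hu' b hb h1) h2
      · exact hI.mixed _ _ h1 (hu' d hd h2)
    exact ne_mod_of_separated hsep (by omega) (by omega) h1 h2 hmod
  rintro _ ⟨a, ha, rfl⟩ _ ⟨b, hb, rfl⟩ _ ⟨c, hc, rfl⟩ _ ⟨d, hd, rfl⟩ he
  refine ⟨rfl, Or.inl ?_⟩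
  simp only [hval ha, hval hb, hval hc, hval hd]
  cases h1 : (t.testBit a ^^ t.testBit c) <;> cases h2 : (t.testBit b ^^ t.testBit d)
  · rfl
  · exact (key a ha b hb c hc d hd he h1 h2).elim
  · exact (key b hb a ha d hd c hc he.symm h2 h1).elim
  · rfl

theorem hasParity_of_affineIn {p : ℕ} [Fact p.Prime] {base l : List ℕ} (hl : ∀ x ∈ l, x < p)
    (hb : HasParity (classes p base)) (h : affineIn p base l = true) :
    HasParity (classes p l) := by
  simp only [affineIn, List.any_eq_true, List.all_eq_true, Bool.and_eq_true, Bool.not_eq_true',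
    Nat.beq_eq] at h
  obtain ⟨a, ha, c, hc, hac, h1, h2⟩ := h
  have hcast : ∀ s : ℕ, (((a + (c + (p - a)) * s) % p : ℕ) : ZMod p) = a + (c - a) * s := by
    intro s
    rw [ZMod.natCast_mod]
    push_cast [Nat.cast_sub (hl a ha).le]
    rw [ZMod.natCast_self]
    ring
  refine hb.affine (a : ZMod p) (c - a) (isUnit_iff_ne_zero.2 fun h0 =>
    Nat.ne_of_beq_eq_false hac ?_) fun y => ⟨?_, ?_⟩
  · have h0 := (ZMod.natCast_eq_natCast_iff' _ _ _).1 (sub_eq_zero.1 h0)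
    rwa [Nat.mod_eq_of_lt (hl c hc), Nat.mod_eq_of_lt (hl a ha), eq_comm] at h0
  · rintro ⟨y, hy, rfl⟩
    obtain ⟨s, hs, rfl⟩ := h1 y hy
    exact ⟨s, ⟨s, hs, rfl⟩, (hcast s).symm⟩
  · rintro ⟨_, ⟨s, hs, rfl⟩, rfl⟩
    obtain ⟨y, hy, he⟩ := h2 s hs
    exact ⟨y, hy, by rw [← he, hcast]⟩

theorem hasParity_of_search {p : ℕ} [Fact p.Prime] {base : List ℕ}
    (hb : HasParity (classes p base)) {xs : List ℕ} (hxs : ∀ x ∈ xs, x < p) {k : ℕ} {l s : List ℕ}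
    (hl : ∀ x ∈ l, x < p) (h : search p base xs k l = true) (hs : s.Sublist xs)
    (hk : s.length ≤ k) : HasParity (classes p (s.reverse ++ l)) := by
  have leaf : ∀ {l : List ℕ}, (∀ x ∈ l, x < p) →
      (splits p l 0 0 0 0 || affineIn p base l) = true → HasParity (classes p l) := fun hl h =>
    (Bool.or_eq_true _ _ ▸ h).elim (hasParity_of_splits hl) (hasParity_of_affineIn hl hb)
  induction xs generalizing k l s with
  | nil =>
    obtain rfl := List.sublist_nil.1 hs
    exact leaf hl (by simpa only [search, List.reverse_nil, List.nil_append] using h)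
  | cons x xs ih =>
    have hxs' : ∀ y ∈ xs, y < p := fun y hy => hxs y (List.mem_cons_of_mem _ hy)
    cases k with
    | zero =>
      obtain rfl := List.eq_nil_of_length_eq_zero (Nat.le_zero.1 hk)
      exact leaf hl (by simpa only [search, List.reverse_nil, List.nil_append] using h)
    | succ k =>
      simp only [search, Bool.and_eq_true] at h
      cases hs with
      | cons _ hs => exact ih hxs' hl h.2 hs hk
      | cons_cons _ hs =>
        have := ih (l := x :: l) hxs'
          (by simpa using ⟨hxs x List.mem_cons_self, hl⟩) h.1 hs (by simpa using hk)
        simpa using this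

/-- It suffices to search the sets that contain `0` and `1`. -/
theorem hasParity_of_ncard_le {p k : ℕ} [Fact p.Prime] {base : List ℕ}
    (hb : HasParity (classes p base)) (h : search p base (List.range' 2 (p - 2)) k [1, 0] = true)
    (S : Set (ZMod p)) (h2 : 2 ≤ S.ncard) (hk : S.ncard ≤ k + 2) : HasParity S := by
  classical
  have hp := (Fact.out : p.Prime).two_le
  obtain ⟨a, c, ha, hc, hac⟩ := (Set.one_lt_ncard_iff (Set.toFinite S)).1 h2
  have hca : c - a ≠ 0 := sub_ne_zero.2 hac.symm
  -- In the affine coordinate where `a` is 0 and `c` is 1, these are the other elements of `S`.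
  let s : List ℕ := (List.range' 2 (p - 2)).filter fun n : ℕ => a + (c - a) * (n : ZMod p) ∈ S
  have hmem : ∀ n, n ∈ s ↔ (2 ≤ n ∧ n < p) ∧ a + (c - a) * (n : ZMod p) ∈ S := by
    intro n
    simp only [s, List.mem_filter, List.mem_range'_1, decide_eq_true_eq]
    rw [show 2 + (p - 2) = p by omega]
  have hnodup : (1 :: 0 :: s).Nodup := by
    have : s.Nodup := (List.nodup_range' (s := 2) (n := p - 2)).filter _
    simp [this, hmem]
  have hcl : (Set.InjOn (fun n : ℕ => a + (c - a) * (n : ZMod p)) {n | n < p}) := by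
    intro m hm n hn he
    have := mul_left_cancel₀ hca (add_left_cancel he)
    have := (ZMod.natCast_eq_natCast_iff' _ _ _).1 this
    rwa [Nat.mod_eq_of_lt hm, Nat.mod_eq_of_lt hn] at this
  have hlen : s.length + 2 ≤ S.ncard := by
    have hsub : (fun n : ℕ => a + (c - a) * (n : ZMod p)) '' ((1 :: 0 :: s).toFinset : Set ℕ) ⊆ S := by
      rintro _ ⟨n, hn, rfl⟩
      simp only [List.coe_toFinset, List.mem_cons, Set.mem_ofPred_eq] at hn
      rcases hn with rfl | rfl | hn
      · simpa using hc
      · simpa using ha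
      · exact ((hmem n).1 hn).2
    have h3 := Set.ncard_le_ncard hsub (Set.toFinite S)
    rw [Set.InjOn.ncard_image, Set.ncard_coe_finset, List.toFinset_card_of_nodup hnodup] at h3
    · simpa only [List.length_cons] using h3
    · refine hcl.mono fun n hn => ?_
      simp only [List.coe_toFinset, List.mem_cons, Set.mem_ofPred_eq] at hn ⊢
      rcases hn with rfl | rfl | hn
      · omega
      · omega
      · exact ((hmem n).1 hn).1.2
  have hpar := hasParity_of_search hb (xs := List.range' 2 (p - 2))
    (fun x hx => by rw [List.mem_range'_1] at hx; omega) (l := [1, 0])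
    (by simp; omega) h (s := s) List.filter_sublist (by omega)
  refine hpar.affine a (c - a) hca.isUnit fun y => ⟨fun hy => ?_, ?_⟩
  · have hz : a + (c - a) * ((y - a) / (c - a)) = y := by rw [mul_div_cancel₀ _ hca]; ring
    refine ⟨(y - a) / (c - a), ⟨((y - a) / (c - a)).val, ?_, ZMod.natCast_zmod_val _⟩, hz⟩
    rw [List.mem_append, List.mem_reverse, hmem, ZMod.natCast_zmod_val, hz]
    have := ZMod.val_lt ((y - a) / (c - a))
    simp only [List.mem_cons, List.not_mem_nil, or_false, hy, and_true]
    omega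
  · rintro ⟨_, ⟨n, hn, rfl⟩, rfl⟩
    simp only [List.mem_append, List.mem_reverse, List.mem_cons, List.not_mem_nil, or_false] at hn
    rcases hn with hn | rfl | rfl
    · exact ((hmem n).1 hn).2
    · simpa using hc
    · simpa using ha

/-! ### The exceptional color sets -/

theorem hasParity_base_thirteen : HasParity (classes 13 [0, 1, 2, 4, 7]) := by
  -- Up to order, the only relation violating the parity of `f` is 7 + 1 = 4 + 4. Its under-strand
  -- sums are 7 + 4 = 11 and 1 + 4 = 5, its over-strand sum is 8.
  refine ⟨fun x => x == 7, fun x => x == 5 || x == 11,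
    ⟨0, ⟨0, by simp, rfl⟩, 7, ⟨7, by simp, rfl⟩, by decide, by decide⟩, ?_⟩
  have h : ∀ a ∈ [0, 1, 2, 4, 7], ∀ b ∈ [0, 1, 2, 4, 7], ∀ c ∈ [0, 1, 2, 4, 7],
      ∀ d ∈ [0, 1, 2, 4, 7], ((a : ℕ) : ZMod 13) + (c : ℕ) = (b : ℕ) + (d : ℕ) →
      (((a : ZMod 13) + b == 5 || (a : ZMod 13) + b == 11) =
        ((c : ZMod 13) + d == 5 || (c : ZMod 13) + d == 11)) ∧
      ((((a : ZMod 13) == 7) ^^ ((c : ZMod 13) == 7)) = (((b : ZMod 13) == 7) ^^ ((d : ZMod 13) == 7)) ∨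
        ((a : ZMod 13) + b == 5 || (a : ZMod 13) + b == 11) ≠
        ((a : ZMod 13) + c == 5 || (a : ZMod 13) + c == 11)) := by
    decide +kernel
  rintro _ ⟨a, ha, rfl⟩ _ ⟨b, hb, rfl⟩ _ ⟨c, hc, rfl⟩ _ ⟨d, hd, rfl⟩
  exact h a ha b hb c hc d hd

theorem hasParity_base_twentynine : HasParity (classes 29 [0, 1, 2, 4, 8, 15]) := by
  -- Here the bad relation is 15 + 1 = 8 + 8, with under-strand sums 23 and 9 and over-strand sum
  -- 16.
  refine ⟨fun x => x == 15, fun x => x == 9 || x == 23,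
    ⟨0, ⟨0, by simp, rfl⟩, 15, ⟨15, by simp, rfl⟩, by decide, by decide⟩, ?_⟩
  have h : ∀ a ∈ [0, 1, 2, 4, 8, 15], ∀ b ∈ [0, 1, 2, 4, 8, 15], ∀ c ∈ [0, 1, 2, 4, 8, 15],
      ∀ d ∈ [0, 1, 2, 4, 8, 15], ((a : ℕ) : ZMod 29) + (c : ℕ) = (b : ℕ) + (d : ℕ) →
      (((a : ZMod 29) + b == 9 || (a : ZMod 29) + b == 23) =
        ((c : ZMod 29) + d == 9 || (c : ZMod 29) + d == 23)) ∧
      ((((a : ZMod 29) == 15) ^^ ((c : ZMod 29) == 15)) =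
          (((b : ZMod 29) == 15) ^^ ((d : ZMod 29) == 15)) ∨
        ((a : ZMod 29) + b == 9 || (a : ZMod 29) + b == 23) ≠
        ((a : ZMod 29) + c == 9 || (a : ZMod 29) + c == 23)) := by
    decide +kernel
  rintro _ ⟨a, ha, rfl⟩ _ ⟨b, hb, rfl⟩ _ ⟨c, hc, rfl⟩ _ ⟨d, hd, rfl⟩
  exact h a ha b hb c hc d hd

end ParitySearch

/-! ### The bounds for 13 and 29 -/

theorem floor_logb_two_thirteen : ⌊Real.logb 2 ((13 : ℕ) : ℝ)⌋₊ = 3 :=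
  (Real.natFloor_logb_natCast 2 13).trans (by norm_num)

theorem floor_logb_two_twentynine : ⌊Real.logb 2 ((29 : ℕ) : ℝ)⌋₊ = 4 :=
  (Real.natFloor_logb_natCast 2 29).trans (by norm_num)

open ParitySearch in
theorem lt_mincol_of_mem (p : ℕ) (hp : p = 13 ∨ p = 29) (K : Knot) (hK : K.DehnColorable p) :
    ⌊Real.logb 2 (p : ℝ)⌋₊ + 2 < K.mincol p := by
  rcases hp with rfl | rfl
  · have : Fact (Nat.Prime 13) := ⟨by norm_num⟩
    rw [floor_logb_two_thirteen]
    exact Knot.lt_mincol (hasParity_of_ncard_le hasParity_base_thirteen search_thirteen) hK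
  · have : Fact (Nat.Prime 29) := ⟨by norm_num⟩
    rw [floor_logb_two_twentynine]
    exact Knot.lt_mincol (hasParity_of_ncard_le hasParity_base_twentynine search_twentynine) hK

theorem theorem5p1 (p : ℕ) (hp : p = 13 ∨ p = 29) :
    (∀ K : Knot, K.DehnColorable p → ⌊Real.logb 2 (p : ℝ)⌋₊ + 3 ≤ K.mincol p) ∧
    ¬ ∃ K : Knot, K.DehnColorable p ∧ K.mincol p = ⌊Real.logb 2 (p : ℝ)⌋₊ + 2 :=
  ⟨lt_mincol_of_mem p hp, fun ⟨K, hK, h⟩ => (lt_mincol_of_mem p hp K hK).ne' h⟩
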